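/- Let $L$ be an even lattice of signature $(p,q)$ with $p\le q$ and Witt index $p$, with dual lattice $L^\vee$, discriminant group $A_L=L^\vee/L$, discriminant form $q_L(x)=(x,x)/2+\mathbb Z$, and $\sigma=p-q$. Let $\mathbb C A_L$ have standard basis $(\mathbf e_\lambda)_{\lambda\in A_L}$, write $e(x)=\exp(2\pi i x)$, and let $\rho_L$ be the Weil representation of $\mathrm{Mp}_2(\mathbb Z)$ on $\mathbb C A_L$, determined by $$\rho_L(T)\mathbf e_\lambda=e(q_L(\lambda))\,\mathbf e_\lambda,\qquad \rho_L(S)\mathbf e_\lambda=\frac{e(-\sigma/8)}{\sqrt{|A_L|}}\sum_{\mu\in A_L}e(-(\lambda,\mu))\,\mathbf e_\mu ,$$ where $T=\left(\begin{pmatrix}1&1\\0&1\end{pmatrix},1\right)$ and $S=\left(\begin{pmatrix}0&-1\\1&0\end{pmatrix},\sqrt\tau\right)$. Let $M^!(L)$ be the space of weakly holomorphic modular forms (holomorphic on the upper half plane, meromorphic at the cusp) of weight $\sigma/2$ and type $\rho_L$. For an even overlattice $L\subset M\subset L^\vee$, the pushforward $\downarrow^L_M:\mathbb C A_L\to\mathbb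 C A_M$ is the linear map that sends $\mathbf e_\mu$ to $\mathbf e_{p(\mu)}$ if $\mu\in M^\vee/L=(M/L)^\perp$, where $p:M^\vee/L\to M^\vee/M=A_M$ is the projection, and to $0$ otherwise. Let $I\subset L$ be a maximal (primitive, of rank $p$) isotropic sublattice. Put $I^*=I_{\mathbb Q}\cap L^\vee$, $L^*=\langle L,I^*\rangle$, and $K=(I^\perp\cap L)/I$, a negative-definite even lattice. There is a canonical identification $A_{L^*}= A_K$, which sends the class of $x\in (L^*)^\vee\cap I^\perp$ to the class of $x$ modulo $I_{\mathbb Q}$. Let $\downarrow^L_K$ be $\downarrow^L_{L^*}$ followed by this identification, and let $\Theta_{K^+}(\tau)=\sum_{l\in K^\vee}e^{-\pi i\tau (l,l)}\,\mathbf e_{[l]}^\vee$ be the theta series of $K^+=K(-1)$. The $\Theta$-product of $f,g\in M^!(L)$ with respect to $I$ is $$f*_I g=\langle f{\downarrow^L_K},\Theta_{K^+}\rangle\cdot g .$$ **Proposition.** Let $L'\subset L$ be a sublattice of finite index with $L=\langle L',I\rangle$, and put $I'=I\cap L'$. Then $f\mapsto f{\downarrow^{L'}_L}$ is a $\mathbb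 C$-linear map from $M^!(L')$ to $M^!(L)$, and it is compatible with the $\Theta$-products: $$(f{\downarrow^{L'}_L})*_I(g{\downarrow^{L'}_L})=(f*_{I'}g){\downarrow^{L'}_L}\qquad\text{for all } f,g\in M^!(L').$$ -/

import Mathlib

open UpperHalfPlane
open scoped MatrixGroups Manifold

namespace ThetaProduct

noncomputable section

/-! ### The metaplectic group -/

/-- An element `(M, φ)` of `Mp₂(ℤ)`: a matrix `M = (a b; c d) ∈ SL₂(ℤ)` and a holomorphic function
`φ` on the upper half plane with `φ(τ)² = cτ + d`. -/
@[ext]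
structure Mp2Z where
  mat : SL(2, ℤ)
  fn : ℍ → ℂ
  holo : MDifferentiable 𝓘(ℂ) 𝓘(ℂ) fn
  sq : ∀ τ : ℍ, fn τ ^ 2 = (mat 1 0 : ℂ) * (τ : ℂ) + (mat 1 1 : ℂ)

theorem coe_smul_eq (M : SL(2, ℤ)) (τ : ℍ) :
    ((M • τ : ℍ) : ℂ) = ((M 0 0 : ℂ) * τ + (M 0 1 : ℂ)) / ((M 1 0 : ℂ) * τ + (M 1 1 : ℂ)) := by
  rw [UpperHalfPlane.coe_specialLinearGroup_apply]
  simp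

theorem denom_ne_zero' (M : SL(2, ℤ)) (τ : ℍ) : (M 1 0 : ℂ) * (τ : ℂ) + (M 1 1 : ℂ) ≠ 0 := by
  have h := UpperHalfPlane.denom_ne_zero (M : GL (Fin 2) ℝ) τ
  simpa [UpperHalfPlane.denom] using h

theorem cocycle (M N : SL(2, ℤ)) (τ : ℍ) :
    ((M 1 0 : ℂ) * ((N • τ : ℍ) : ℂ) + (M 1 1 : ℂ)) * ((N 1 0 : ℂ) * (τ : ℂ) + (N 1 1 : ℂ)) =
      ((M * N) 1 0 : ℂ) * (τ : ℂ) + ((M * N) 1 1 : ℂ) := by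
  rw [coe_smul_eq]
  have h := denom_ne_zero' N τ
  simp only [Matrix.SpecialLinearGroup.coe_mul, Matrix.mul_apply, Fin.sum_univ_two]
  push_cast
  generalize (τ : ℂ) = z at *
  generalize ((N 1 0 : ℤ) : ℂ) = c at *
  generalize ((N 1 1 : ℤ) : ℂ) = d at *
  rw [add_mul, mul_assoc, div_mul_cancel₀ _ h]
  ring

theorem mdifferentiable_SL_smul (M : SL(2, ℤ)) :
    MDifferentiable 𝓘(ℂ) 𝓘(ℂ) (fun τ : ℍ => M • τ) := by
  apply UpperHalfPlane.mdifferentiable_smul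
  simp

/-- The group law `(M, φ)(N, ψ) = (MN, φ(Nτ)ψ(τ))`. -/
instance : Monoid Mp2Z where
  mul a b :=
    { mat := a.mat * b.mat
      fn := fun τ => a.fn (b.mat • τ) * b.fn τ
      holo := (a.holo.comp (mdifferentiable_SL_smul b.mat)).mul b.holo
      sq := fun τ => by rw [mul_pow, a.sq, b.sq, cocycle] }
  one :=
    { mat := 1
      fn := fun _ => 1
      holo := mdifferentiable_const
      sq := fun τ => by simp }
  mul_assoc a b c := by
    refine Mp2Z.ext (mul_assoc a.mat b.mat c.mat) ?_
    funext τ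
    change a.fn (b.mat • c.mat • τ) * b.fn (c.mat • τ) * c.fn τ =
      a.fn ((b.mat * c.mat) • τ) * (b.fn (c.mat • τ) * c.fn τ)
    rw [mul_smul, mul_assoc]
  one_mul a := by
    refine Mp2Z.ext (one_mul a.mat) ?_
    funext τ
    exact one_mul _
  mul_one a := by
    refine Mp2Z.ext (mul_one a.mat) ?_
    funext τ
    change a.fn ((1 : SL(2, ℤ)) • τ) * 1 = a.fn τ
    rw [one_smul, mul_one]

/-- The element `T = ((1 1; 0 1), 1)`. -/
def Mp2Z.T : Mp2Z where
  mat := ModularGroup.T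
  fn := fun _ => 1
  holo := mdifferentiable_const
  sq := fun τ => by simp [ModularGroup.T]

/-- The element `S = ((0 -1; 1 0), √τ)`, with the principal branch of the square root. -/
def Mp2Z.S : Mp2Z where
  mat := ModularGroup.S
  fn := fun τ => (τ : ℂ) ^ (1 / 2 : ℂ)
  holo := by
    intro τ
    have h : DifferentiableAt ℂ (fun z : ℂ => z ^ (1 / 2 : ℂ)) (τ : ℂ) :=
      DifferentiableAt.cpow_const differentiableAt_id (Or.inr τ.im_pos.ne')
    exact h.mdifferentiableAt.comp τ τ.mdifferentiable_coe
  sq := fun τ => by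
    rw [← Complex.cpow_nat_mul]
    simp [ModularGroup.S]

/-! ### Lattices and discriminant groups -/

section Lattice

variable {V : Type*} [AddCommGroup V] [Module ℚ V]

/-- `L` is an even lattice in the rational quadratic space `(V, B)`: a finitely generated
subgroup spanning `V` on which `B` is integral and `B x x` is even. -/
structure IsEvenLattice (B : LinearMap.BilinForm ℚ V) (L : Submodule ℤ V) : Prop where
  isLattice : Submodule.IsLattice ℚ L
  integral : ∀ x ∈ L, ∀ y ∈ L, ∃ n : ℤ, B x y = n
  even : ∀ x ∈ L, ∃ n : ℤ, B x x = 2 * n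

/-- `I` is a primitive isotropic sublattice of `L` of rank `p`. -/
structure IsMaximalIsotropic (B : LinearMap.BilinForm ℚ V) (L I : Submodule ℤ V) (p : ℕ) :
    Prop where
  le : I ≤ L
  isotropic : ∀ x ∈ I, ∀ y ∈ I, B x y = 0
  primitive : ∀ (n : ℤ) (x : V), n ≠ 0 → x ∈ L → n • x ∈ I → x ∈ I
  rank : Module.finrank ℤ I = p

/-- The number `σ = p - q` for `(V, B)` of signature `(p, q)`. -/
def sigma (B : LinearMap.BilinForm ℚ V) : ℤ :=
  (sigPos B.toQuadraticMap : ℤ) - sigNeg B.toQuadraticMap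

variable (B : LinearMap.BilinForm ℚ V) (L M : Submodule ℤ V)

/-- The discriminant group `A_L = L^∨ / L`. -/
abbrev DiscGroup : Type _ := B.dualSubmodule L ⧸ L.submoduleOf (B.dualSubmodule L)

/-- The class in `A_L` of an element of `L^∨`. -/
abbrev discMk : B.dualSubmodule L →ₗ[ℤ] DiscGroup B L :=
  (L.submoduleOf (B.dualSubmodule L)).mkQ

/-- The space `ℂA_L` with standard basis `e_λ = Finsupp.single λ 1`. -/
abbrev CA : Type _ := DiscGroup B L →₀ ℂ

/-- The basis vector `e_λ`. -/
abbrev basisVec (l : DiscGroup B L) : CA B L := Finsupp.single l 1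

/-- `e(x) = exp(2πix)`. -/
def e (x : ℚ) : ℂ := Complex.exp (2 * Real.pi * Complex.I * (x : ℂ))

/-- `e(q(λ))` for `λ ∈ A_L`, where `q(λ) = (x, x)/2 + ℤ` for a representative `x ∈ L^∨`
(see `eQuad_mk`). -/
def eQuad (l : DiscGroup B L) : ℂ :=
  e (B (Quotient.out l : B.dualSubmodule L) (Quotient.out l : B.dualSubmodule L) / 2)

/-- `e(-(λ, μ))` for `λ, μ ∈ A_L`, where `(λ, μ) = (x, y) + ℤ` for representatives `x, y ∈ L^∨`
(see `ePairNeg_mk`). -/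
def ePairNeg (l m : DiscGroup B L) : ℂ :=
  e (-(B (Quotient.out l : B.dualSubmodule L) (Quotient.out m : B.dualSubmodule L)))

theorem e_add_int (x : ℚ) (n : ℤ) : e (x + n) = e x := by
  unfold e
  rw [Complex.exp_eq_exp_iff_exists_int]
  exact ⟨n, by push_cast; ring⟩

variable {B L}

theorem mem_dual_iff {x : V} : x ∈ B.dualSubmodule L ↔ ∀ y ∈ L, ∃ n : ℤ, B x y = n := by
  rw [LinearMap.BilinForm.mem_dualSubmodule]
  simp only [Submodule.mem_one]
  constructor
  · intro h y hy
    obtain ⟨n, hn⟩ := h y hy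
    exact ⟨n, by simpa using hn.symm⟩
  · intro h y hy
    obtain ⟨n, hn⟩ := h y hy
    exact ⟨n, by simpa using hn.symm⟩

theorem discMk_eq_iff {x y : B.dualSubmodule L} :
    discMk B L x = discMk B L y ↔ (x : V) - y ∈ L := by
  simp only [Submodule.mkQ_apply]
  rw [Submodule.Quotient.eq]
  rfl

theorem out_sub_mem (x : B.dualSubmodule L) :
    ((Quotient.out (discMk B L x) : B.dualSubmodule L) : V) - x ∈ L := by
  rw [← discMk_eq_iff]
  exact Quotient.out_eq (discMk B L x)

theorem eQuad_mk (hB : B.IsSymm) (hL : IsEvenLattice B L) (x : B.dualSubmodule L) :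
    eQuad B L (discMk B L x) = e (B x x / 2) := by
  unfold eQuad
  set y := (Quotient.out (discMk B L x) : B.dualSubmodule L)
  have hd : (y : V) - x ∈ L := out_sub_mem x
  obtain ⟨m, hm⟩ := hL.even _ hd
  obtain ⟨n, hn⟩ := mem_dual_iff.1 x.2 _ hd
  have h : B y y / 2 = B x x / 2 + ((m + n : ℤ) : ℚ) := by
    have h1 : B (x : V) ((y : V) - x) = B ((y : V) - x) x := hB.eq _ _
    have h2 : B (y : V) y = B (x : V) x + B (x : V) ((y : V) - x) + B ((y : V) - x) x +
        B ((y : V) - x) ((y : V) - x) := by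
      simp only [map_sub, LinearMap.sub_apply]
      ring
    rw [h2, ← h1, hm, hn]
    push_cast
    ring
  rw [h, e_add_int]

theorem ePairNeg_mk (hB : B.IsSymm) (x y : B.dualSubmodule L) :
    ePairNeg B L (discMk B L x) (discMk B L y) = e (-(B x y)) := by
  unfold ePairNeg
  set x' := (Quotient.out (discMk B L x) : B.dualSubmodule L)
  set y' := (Quotient.out (discMk B L y) : B.dualSubmodule L)
  have hx : (x' : V) - x ∈ L := out_sub_mem x
  have hy : (y' : V) - y ∈ L := out_sub_mem y
  obtain ⟨m, hm⟩ := mem_dual_iff.1 x'.2 _ hy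
  obtain ⟨n, hn⟩ := mem_dual_iff.1 y.2 _ hx
  have h : -(B x' y') = -(B x y) + ((-(m + n) : ℤ) : ℚ) := by
    have h1 : B (y : V) ((x' : V) - x) = B ((x' : V) - x) y := hB.eq _ _
    have h2 : B (x' : V) y' = B (x : V) y + B ((x' : V) - x) y + B (x' : V) ((y' : V) - y) := by
      simp only [map_sub, LinearMap.sub_apply]
      ring
    rw [h2, ← h1, hm, hn]
    push_cast
    ring
  rw [h, e_add_int]

variable (B L)

/-! ### The Weil representation -/

/-- `ρ_L(T) e_λ = e(q(λ)) e_λ`. -/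
def weilT : Module.End ℂ (CA B L) :=
  Finsupp.linearCombination ℂ fun l => eQuad B L l • basisVec B L l

/-- `ρ_L(S) e_λ = e(-σ(L)/8) / √|A_L| * ∑_μ e(-(λ, μ)) e_μ`. -/
def weilS : Module.End ℂ (CA B L) :=
  Finsupp.linearCombination ℂ fun l =>
    (e (-(sigma B : ℚ) / 8) / (Real.sqrt (Nat.card (DiscGroup B L)) : ℂ)) •
      ∑ᶠ m : DiscGroup B L, ePairNeg B L l m • basisVec B L m

/-- The graph of the Weil representation `ρ_L : Mp₂(ℤ) → GL(ℂA_L)`, i.e. the set of all pairs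
`(g, ρ_L(g))`. As `Mp₂(ℤ)` is generated by `T` and `S` (as a monoid, `S` being of finite order
and `(ST)³ = S²`), and `ρ_L` is defined by its values on `T` and `S`, it is the submonoid
generated by `(T, ρ_L(T))` and `(S, ρ_L(S))`. -/
def weilGraph : Submonoid (Mp2Z × Module.End ℂ (CA B L)) :=
  Submonoid.closure {(Mp2Z.T, weilT B L), (Mp2Z.S, weilS B L)}

/-- `f` is a weakly holomorphic modular form of weight `σ(L)/2` and type `ρ_L`: it is holomorphic,
`f(Mτ) = φ(τ)^{σ(L)} ρ_L(M, φ) f(τ)` for all `(M, φ) ∈ Mp₂(ℤ)`, and it is meromorphic at the cusp,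
that is, each component is `O(|q|^{-N})` for some `N` as `Im τ → ∞`. -/
structure IsWeaklyHolomorphic (f : ℍ → CA B L) : Prop where
  holo : ∀ l, MDifferentiable 𝓘(ℂ) 𝓘(ℂ) fun τ => f τ l
  modular : ∀ g R, (g, R) ∈ weilGraph B L → ∀ τ : ℍ,
    f (g.mat • τ) = (g.fn τ ^ sigma B) • R (f τ)
  cusp : ∀ l, ∃ N : ℕ, (fun τ => f τ l) =O[atImInfty]
    fun τ : ℍ => Real.exp (2 * Real.pi * N * τ.im)

/-- The space `M^!(L)` of weakly holomorphic modular forms of weight `σ(L)/2` and type `ρ_L`. -/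
def MShriek : Submodule ℂ (ℍ → CA B L) where
  carrier := {f | IsWeaklyHolomorphic B L f}
  zero_mem' :=
    { holo := fun l => mdifferentiable_const
      modular := fun g R _ τ => by simp
      cusp := fun l => ⟨0, Asymptotics.isBigO_zero _ _⟩ }
  add_mem' {f g} hf hg :=
    { holo := fun l => (hf.holo l).add (hg.holo l)
      modular := fun a R h τ => by
        simp only [Pi.add_apply, hf.modular a R h τ, hg.modular a R h τ, map_add, smul_add]
      cusp := fun l => by
        obtain ⟨N, hN⟩ := hf.cusp l
        obtain ⟨N', hN'⟩ := hg.cusp l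
        have key : ∀ a b : ℕ, a ≤ b → (fun τ : ℍ => Real.exp (2 * Real.pi * a * τ.im)) =O[atImInfty]
            fun τ : ℍ => Real.exp (2 * Real.pi * b * τ.im) := by
          intro a b hab
          refine Asymptotics.IsBigO.of_norm_le fun τ => ?_
          rw [Real.norm_eq_abs, abs_of_pos (Real.exp_pos _)]
          refine Real.exp_le_exp.2 ?_
          have : (a : ℝ) ≤ b := by exact_mod_cast hab
          have := τ.im_pos
          gcongr
        exact ⟨max N N', (hN.trans (key _ _ (le_max_left _ _))).add
          (hN'.trans (key _ _ (le_max_right _ _)))⟩ }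
  smul_mem' c f hf :=
    { holo := fun l => (hf.holo l).const_smul c
      modular := fun a R h τ => by
        simp only [Pi.smul_apply, hf.modular a R h τ, map_smul]
        rw [smul_comm]
      cusp := fun l => by
        obtain ⟨N, hN⟩ := hf.cusp l
        exact ⟨N, hN.const_smul_left c⟩ }

/-! ### Pushforward to an overlattice -/

open Classical in
/-- The pushforward `↓^L_M : ℂA_L → ℂA_M` to an even overlattice `L ⊆ M ⊆ L^∨`. The orthogonal
complement of `J = M/L` in `A_L` is `J^⊥ = M^∨/L`, and `p : J^⊥ → A_M = M^∨/M` is the projection;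
`e_μ` goes to `e_{p(μ)}` if `μ ∈ J^⊥` and to `0` otherwise (see `push_basisVec_mk` and
`push_basisVec_of_notMem`). -/
def push : CA B L →ₗ[ℂ] CA B M :=
  Finsupp.linearCombination ℂ fun l =>
    if h : ∃ x : B.dualSubmodule M, ∃ hx : (x : V) ∈ B.dualSubmodule L, discMk B L ⟨x, hx⟩ = l
    then basisVec B M (discMk B M h.choose) else 0

variable {B L M}

theorem push_basisVec_mk (hLM : L ≤ M) (x : V) (hx : x ∈ B.dualSubmodule L)
    (hx' : x ∈ B.dualSubmodule M) :
    push B L M (basisVec B L (discMk B L ⟨x, hx⟩)) = basisVec B M (discMk B M ⟨x, hx'⟩) := by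
  have h : ∃ y : B.dualSubmodule M, ∃ hy : (y : V) ∈ B.dualSubmodule L,
      discMk B L ⟨y, hy⟩ = discMk B L ⟨x, hx⟩ := ⟨⟨x, hx'⟩, hx, rfl⟩
  unfold push
  rw [Finsupp.linearCombination_single, one_smul, dif_pos h]
  obtain ⟨hy, hy'⟩ := h.choose_spec
  congr 1
  rw [discMk_eq_iff] at hy' ⊢
  exact hLM hy'

theorem push_basisVec_of_notMem (hM : L ≤ B.dualSubmodule M) (x : V)
    (hx : x ∈ B.dualSubmodule L) (hx' : x ∉ B.dualSubmodule M) :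
    push B L M (basisVec B L (discMk B L ⟨x, hx⟩)) = 0 := by
  unfold push
  rw [Finsupp.linearCombination_single, one_smul, dif_neg]
  rintro ⟨y, hy, h⟩
  rw [discMk_eq_iff] at h
  refine hx' ?_
  have := Submodule.sub_mem _ y.2 (hM h)
  simpa using this

/-! ### The lattices `L^*` and `K = (I^⊥ ∩ L)/I` -/

/-- The form on `U^⊥/U` induced by `B` (for `U` isotropic; in general on `U^⊥/(U ∩ U^⊥)`). -/
def quotForm (hB : B.IsSymm) (U : Submodule ℚ V) :
    LinearMap.BilinForm ℚ (B.orthogonal U ⧸ U.submoduleOf (B.orthogonal U)) :=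
  (U.submoduleOf (B.orthogonal U)).liftQ
    (LinearMap.flip ((U.submoduleOf (B.orthogonal U)).liftQ
      (LinearMap.flip (B.restrict (B.orthogonal U)))
      (by
        intro u hu
        rw [LinearMap.mem_ker]
        ext x
        change B (x : V) (u : V) = 0
        rw [← hB.eq]
        exact x.2 u hu)))
    (by
      intro u hu
      rw [LinearMap.mem_ker]
      ext x
      change B (u : V) (x : V) = 0
      exact x.2 u hu)

theorem quotForm_mk (hB : B.IsSymm) (U : Submodule ℚ V) (x y : B.orthogonal U) :
    quotForm hB U (Submodule.Quotient.mk x) (Submodule.Quotient.mk y) = B x y := rfl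

variable (B) in
/-- `I^* = I_ℚ ∩ L^∨`. -/
def Istar (L I : Submodule ℤ V) : Submodule ℤ V :=
  (Submodule.span ℚ (I : Set V)).restrictScalars ℤ ⊓ B.dualSubmodule L

variable (B) in
/-- `L^* = ⟨L, I^*⟩`. -/
def Lstar (L I : Submodule ℤ V) : Submodule ℤ V := L ⊔ Istar B L I

variable (B) in
/-- The quotient space `I_ℚ^⊥ / I_ℚ`. -/
abbrev QuotSpace (I : Submodule ℤ V) : Type _ :=
  B.orthogonal (Submodule.span ℚ (I : Set V)) ⧸
    (Submodule.span ℚ (I : Set V)).submoduleOf (B.orthogonal (Submodule.span ℚ (I : Set V)))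

variable (B) in
/-- The projection `I_ℚ^⊥ → I_ℚ^⊥ / I_ℚ`. -/
abbrev quotMk (I : Submodule ℤ V) :
    B.orthogonal (Submodule.span ℚ (I : Set V)) →ₗ[ℚ] QuotSpace B I :=
  ((Submodule.span ℚ (I : Set V)).submoduleOf
    (B.orthogonal (Submodule.span ℚ (I : Set V)))).mkQ

/-- The form on `I_ℚ^⊥ / I_ℚ`. -/
abbrev quotB (hB : B.IsSymm) (I : Submodule ℤ V) : LinearMap.BilinForm ℚ (QuotSpace B I) :=
  quotForm hB (Submodule.span ℚ (I : Set V))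

variable (B) in
/-- The negative-definite lattice `K = (I^⊥ ∩ L)/I`, realized as the image of `I^⊥ ∩ L` in
`I_ℚ^⊥ / I_ℚ`. -/
def latticeK (L I : Submodule ℤ V) : Submodule ℤ (QuotSpace B I) :=
  (L.submoduleOf ((B.orthogonal (Submodule.span ℚ (I : Set V))).restrictScalars ℤ)).map
    ((quotMk B I).restrictScalars ℤ)

theorem quotMk_mem_dual (hB : B.IsSymm) (L I : Submodule ℤ V)
    (x : B.orthogonal (Submodule.span ℚ (I : Set V))) (hx : (x : V) ∈ B.dualSubmodule (Lstar B L I)) :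
    quotMk B I x ∈ (quotB hB I).dualSubmodule (latticeK B L I) := by
  rw [mem_dual_iff]
  rintro _ ⟨y, hy, rfl⟩
  have hy' : (y : V) ∈ L := hy
  exact mem_dual_iff.1 hx _ (Submodule.mem_sup_left hy')

open Classical in
/-- The canonical identification `A_{L^*} ≃ A_K`: a class in `A_{L^*}` is represented by some
`x ∈ (L^*)^∨ ∩ I^⊥`, and goes to the class of `x mod I_ℚ` (see `discIso_mk` and
`exists_orthogonal_rep`). -/
def discIso (hB : B.IsSymm) (L I : Submodule ℤ V) (l : DiscGroup B (Lstar B L I)) :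
    DiscGroup (quotB hB I) (latticeK B L I) :=
  if h : ∃ x : B.orthogonal (Submodule.span ℚ (I : Set V)),
      ∃ hx : (x : V) ∈ B.dualSubmodule (Lstar B L I), discMk B (Lstar B L I) ⟨x, hx⟩ = l
  then discMk (quotB hB I) (latticeK B L I)
    ⟨quotMk B I h.choose, quotMk_mem_dual hB L I _ h.choose_spec.choose⟩
  else 0

theorem span_isotropic {I : Submodule ℤ V} (hI : ∀ x ∈ I, ∀ y ∈ I, B x y = 0) :
    Submodule.span ℚ (I : Set V) ≤ B.orthogonal (Submodule.span ℚ (I : Set V)) := by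
  intro x hx y hy
  change B y x = 0
  induction hy using Submodule.span_induction with
  | zero => simp
  | add a b _ _ ha hb => simp [ha, hb]
  | smul c a _ ha => simp [ha]
  | mem a ha =>
    induction hx using Submodule.span_induction with
    | zero => simp
    | add u v _ _ hu hv => simp [hu, hv]
    | smul c u _ hu => simp [hu]
    | mem u hu => exact hI a ha u hu

theorem discIso_mk (hB : B.IsSymm) {L I : Submodule ℤ V} (hI : ∀ x ∈ I, ∀ y ∈ I, B x y = 0)
    (x : B.orthogonal (Submodule.span ℚ (I : Set V)))
    (hx : (x : V) ∈ B.dualSubmodule (Lstar B L I)) :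
    discIso hB L I (discMk B (Lstar B L I) ⟨x, hx⟩) =
      discMk (quotB hB I) (latticeK B L I) ⟨quotMk B I x, quotMk_mem_dual hB L I x hx⟩ := by
  have h : ∃ y : B.orthogonal (Submodule.span ℚ (I : Set V)),
      ∃ hy : (y : V) ∈ B.dualSubmodule (Lstar B L I),
        discMk B (Lstar B L I) ⟨y, hy⟩ = discMk B (Lstar B L I) ⟨x, hx⟩ := ⟨x, hx, rfl⟩
  unfold discIso
  rw [dif_pos h, discMk_eq_iff]
  have h' := h.choose_spec.choose_spec
  rw [discMk_eq_iff] at h'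
  obtain ⟨l, hl, i, hi, hli⟩ := Submodule.mem_sup.1 h'
  set y := h.choose
  have hiU : i ∈ Submodule.span ℚ (I : Set V) := hi.1
  have hlO : l ∈ B.orthogonal (Submodule.span ℚ (I : Set V)) := by
    have : l = (y : V) - x - i := by rw [← hli]; simp
    rw [this]
    exact Submodule.sub_mem _ (Submodule.sub_mem _ y.2 x.2) (span_isotropic hI hiU)
  refine ⟨⟨l, hlO⟩, hl, ?_⟩
  change quotMk B I ⟨l, hlO⟩ = quotMk B I y - quotMk B I x
  rw [← map_sub]
  refine (Submodule.Quotient.eq _).2 ?_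
  change l - ((y : V) - x) ∈ Submodule.span ℚ (I : Set V)
  rw [← hli]
  simpa using hiU

theorem exists_sub_mem_orthogonal (hB : B.IsSymm) (hnd : B.Nondegenerate) {L I : Submodule ℤ V}
    (hL : IsEvenLattice B L) (hIL : I ≤ L) (x : V) (hx : x ∈ B.dualSubmodule (Lstar B L I)) :
    ∃ y ∈ L, x - y ∈ B.orthogonal (Submodule.span ℚ (I : Set V)) := by
  classical
  have := hL.isLattice
  let b := Module.Free.chooseBasis ℤ L
  let b' := b.extendOfIsLattice ℚ
  have hspan : L = Submodule.span ℤ (Set.range b') := by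
    have h1 : Set.range b' = L.subtype '' Set.range b := by
      rw [← Set.range_comp]
      congr 1
      funext i
      simp [b']
    rw [h1, Submodule.span_image, b.span_eq, Submodule.map_top, Submodule.range_subtype]
  let d := B.dualBasis hnd b'
  have hD : B.dualSubmodule L = Submodule.span ℤ (Set.range d) := by
    conv_lhs => rw [hspan]
    exact LinearMap.BilinForm.dualSubmodule_span_of_basis B hnd b'
  have hdD : ∀ i, d i ∈ B.dualSubmodule L := fun i => by
    rw [hD]; exact Submodule.subset_span ⟨i, rfl⟩
  have : Module.Finite ℤ (B.dualSubmodule L) := by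
    rw [Module.Finite.iff_fg, hD]
    exact Submodule.fg_span (Set.finite_range d)
  let N : Submodule ℤ (B.dualSubmodule L) :=
    ((Submodule.span ℚ (I : Set V)).restrictScalars ℤ).submoduleOf (B.dualSubmodule L)
  have : Module.IsTorsionFree ℤ (B.dualSubmodule L ⧸ N) := by
    rw [Module.isTorsionFree_iff_smul_eq_zero]
    intro n z h
    by_contra hc
    push Not at hc
    obtain ⟨hn, hz⟩ := hc
    obtain ⟨z, rfl⟩ := N.mkQ_surjective z
    rw [← map_smul, Submodule.mkQ_apply, Submodule.Quotient.mk_eq_zero] at h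
    apply hz
    rw [Submodule.mkQ_apply, Submodule.Quotient.mk_eq_zero]
    have h' : n • (z : V) ∈ Submodule.span ℚ (I : Set V) := h
    rw [← Int.cast_smul_eq_zsmul ℚ] at h'
    have hn' : (n : ℚ) ≠ 0 := by exact_mod_cast hn
    exact (Submodule.smul_mem_iff (Submodule.span ℚ (I : Set V)) hn').1 h'
  have : Module.Free ℤ (B.dualSubmodule L ⧸ N) := inferInstance
  obtain ⟨s, hs⟩ := N.mkQ.exists_rightInverse_of_surjective (Submodule.range_mkQ N)
  let r : B.dualSubmodule L →ₗ[ℤ] B.dualSubmodule L := LinearMap.id - s ∘ₗ N.mkQ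
  have hr : ∀ z, r z ∈ N := fun z => by
    rw [← Submodule.Quotient.mk_eq_zero, ← Submodule.mkQ_apply]
    have := LinearMap.congr_fun hs (N.mkQ z)
    simp only [r, LinearMap.sub_apply, map_sub, LinearMap.comp_apply, LinearMap.id_apply] at this ⊢
    rw [this, sub_self]
  have hr' : ∀ z ∈ N, r z = z := fun z hz => by
    have : N.mkQ z = 0 := by rwa [Submodule.mkQ_apply, Submodule.Quotient.mk_eq_zero]
    simp [r, -Submodule.mkQ_apply, this]
  let f : B.dualSubmodule L →ₗ[ℤ] ℚ :=
    ((B x).restrictScalars ℤ) ∘ₗ (B.dualSubmodule L).subtype ∘ₗ r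
  have hf : ∀ z, ∃ n : ℤ, f z = n := fun z =>
    mem_dual_iff.1 hx _ (Submodule.mem_sup_right ⟨hr z, (r z).2⟩)
  choose c hc using fun i => hf ⟨d i, hdD i⟩
  refine ⟨∑ i, c i • b' i, ?_, ?_⟩
  · have hb : ∀ i, b' i ∈ L := fun i => by simp [b']
    exact Submodule.sum_mem _ fun i _ => Submodule.smul_mem _ _ (hb i)
  set y := ∑ i, c i • b' i with hy
  have hyd : ∀ i, B y (d i) = f ⟨d i, hdD i⟩ := fun j => by
    rw [hy, hc j]
    simp only [map_sum, LinearMap.sum_apply, map_zsmul, LinearMap.smul_apply]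
    simp [d, LinearMap.BilinForm.apply_dualBasis_right hnd hB b']
  have hyf : ∀ z : B.dualSubmodule L, B y z = f z := by
    rintro ⟨z, hz⟩
    have hz' := hz
    rw [hD] at hz'
    induction hz' using Submodule.span_induction with
    | mem z hz' => obtain ⟨i, rfl⟩ := hz'; exact hyd i
    | zero => exact (map_zero _).trans (map_zero f).symm
    | add u v hu hv h1 h2 =>
      have hu' : u ∈ B.dualSubmodule L := by rw [hD]; exact hu
      have hv' : v ∈ B.dualSubmodule L := by rw [hD]; exact hv
      have : (⟨u + v, hz⟩ : B.dualSubmodule L) = ⟨u, hu'⟩ + ⟨v, hv'⟩ := rfl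
      rw [this, map_add, ← h1 hu', ← h2 hv']
      exact map_add _ _ _
    | smul n u hu h1 =>
      have hu' : u ∈ B.dualSubmodule L := by rw [hD]; exact hu
      have : (⟨n • u, hz⟩ : B.dualSubmodule L) = n • ⟨u, hu'⟩ := rfl
      rw [this, map_zsmul, ← h1 hu']
      exact map_zsmul _ _ _
  intro u hu
  change B u (x - y) = 0
  rw [← hB.eq]
  induction hu using Submodule.span_induction with
  | zero => simp
  | add a b _ _ ha hb => rw [map_add, ha, hb, add_zero]
  | smul c a _ ha => rw [map_smul, ha, smul_zero]
  | mem u hu =>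
    have huD : u ∈ B.dualSubmodule L := mem_dual_iff.2 fun y hy => hL.integral u (hIL hu) y hy
    have h1 := hyf ⟨u, huD⟩
    have h2 : f ⟨u, huD⟩ = B x u := by
      change B x (r ⟨u, huD⟩ : B.dualSubmodule L) = _
      rw [hr' _ (show u ∈ Submodule.span ℚ (I : Set V) from Submodule.subset_span hu)]
    have h3 : B y u = B x u := h1.trans h2
    simp [h3]

theorem exists_orthogonal_rep (hB : B.IsSymm) (hnd : B.Nondegenerate) {L I : Submodule ℤ V}
    (hL : IsEvenLattice B L) (hIL : I ≤ L) (l : DiscGroup B (Lstar B L I)) :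
    ∃ x : B.orthogonal (Submodule.span ℚ (I : Set V)),
      ∃ hx : (x : V) ∈ B.dualSubmodule (Lstar B L I), discMk B (Lstar B L I) ⟨x, hx⟩ = l := by
  obtain ⟨⟨x, hx⟩, rfl⟩ := Submodule.mkQ_surjective _ l
  obtain ⟨y, hy, hxy⟩ := exists_sub_mem_orthogonal hB hnd hL hIL x hx
  have hy' : y ∈ B.dualSubmodule (Lstar B L I) := by
    rw [mem_dual_iff]
    intro w hw
    obtain ⟨a, ha, i, hi, rfl⟩ := Submodule.mem_sup.1 hw
    obtain ⟨m, hm⟩ := hL.integral y hy a ha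
    obtain ⟨n, hn⟩ := mem_dual_iff.1 hi.2 y hy
    refine ⟨m + n, ?_⟩
    rw [map_add, hm, show B y i = n from (hB.eq y i).trans hn]
    push_cast
    rfl
  refine ⟨⟨x - y, hxy⟩, Submodule.sub_mem _ hx hy', ?_⟩
  rw [discMk_eq_iff]
  have : x - y - x = -y := by abel
  rw [this]
  exact Submodule.neg_mem _ (Submodule.mem_sup_left hy)

/-! ### Theta series and the `Θ`-product -/

end Lattice

section Theta

variable {W : Type*} [AddCommGroup W] [Module ℚ W]

/-- The theta series `Θ_{K⁺}` of the positive-definite lattice `K⁺ = K(-1)`, for `K` a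
negative-definite even lattice in `(W, C)`. Its component at `ν ∈ A_{K⁺} = A_K` is
`∑ q^{-(l, l)/2}` over the `l ∈ K^∨` with class `ν`. -/
def thetaSeries (C : LinearMap.BilinForm ℚ W) (K : Submodule ℤ W) (τ : ℍ) (n : DiscGroup C K) : ℂ :=
  ∑' l : {l : C.dualSubmodule K // discMk C K l = n},
    Complex.exp (2 * Real.pi * Complex.I * (τ : ℂ) *
      ((-(C (l : C.dualSubmodule K) (l : C.dualSubmodule K)) / 2 : ℚ) : ℂ))

end Theta

section Product

variable {V : Type*} [AddCommGroup V] [Module ℚ V] {B : LinearMap.BilinForm ℚ V}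

/-- `↓^L_K : ℂA_L → ℂA_{L^*} = ℂA_K`. -/
def pushK (hB : B.IsSymm) (L I : Submodule ℤ V) :
    CA B L →ₗ[ℂ] CA (quotB hB I) (latticeK B L I) :=
  Finsupp.lmapDomain ℂ ℂ (discIso hB L I) ∘ₗ push B L (Lstar B L I)

/-- `ξ(f) = ⟨f↓^L_K, Θ_{K⁺}⟩`, where `⟨v, w⟩ = ∑_ν v_ν w_ν` is the contraction of `ρ_K` with
`ρ_{K⁺} = ρ_K^∨`. -/
def xi (hB : B.IsSymm) (L I : Submodule ℤ V) (f : ℍ → CA B L) (τ : ℍ) : ℂ :=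
  Finsupp.linearCombination ℂ (thetaSeries (quotB hB I) (latticeK B L I) τ) (pushK hB L I (f τ))

/-- The `Θ`-product `f ∗_I g = ξ(f) g`. -/
def thetaProd (hB : B.IsSymm) (L I : Submodule ℤ V) (f g : ℍ → CA B L) (τ : ℍ) : CA B L :=
  xi hB L I f τ • g τ

end Product

end

end ThetaProduct

/-!
Put `J = M / L`. The components of `v↓^L_M` are the sums of `v` over the fibres of
`J^⊥ = M^∨ / L → A_M`. Since `e(q_L)` is constant on these fibres, `↓^L_M` intertwines the two
operators `ρ(T)`; for `ρ(S)` this follows from the orthogonality of the characters of `J` together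
with `|A_L| = |J|² |A_M|`. Hence the pushforward preserves weakly holomorphic forms.

As `I` is isotropic, it pairs trivially with `I_ℚ`, so passing from `(L', I')` to `(L' + I, I)`
changes neither `I_ℚ` nor the lattices `L^*` and `K`. Since pushforwards compose, both contractions
with the theta series are the same functional of the pushforward to `L^*`, and the resulting scalar
function can be pulled out of the linear map `↓^{L'}_L`.
-/

namespace ThetaProduct

noncomputable section

/-! ### Lattices and their duals -/

theorem exists_ne_zero_nsmul_mem {R G : Type*} [Ring R] [AddCommGroup G] [Module R G]
    {H K : Submodule R G} [Finite (K ⧸ H.submoduleOf K)] :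
    ∃ n : ℕ, n ≠ 0 ∧ ∀ x ∈ K, n • x ∈ H := by
  refine ⟨Nat.card (K ⧸ H.submoduleOf K), Nat.card_pos.ne', fun x hx => ?_⟩
  have h := card_nsmul_eq_zero' (x := (H.submoduleOf K).mkQ ⟨x, hx⟩)
  rwa [← map_nsmul, Submodule.mkQ_apply, Submodule.Quotient.mk_eq_zero] at h

section Lattices

variable {V : Type*} [AddCommGroup V] [Module ℚ V] {B : LinearMap.BilinForm ℚ V}
  {L M I : Submodule ℤ V}

theorem mem_span_of_nsmul_mem {n : ℕ} (hn : n ≠ 0) {x : V} {s : Set V} (h : n • x ∈ s) :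
    x ∈ Submodule.span ℚ s := by
  have hx : (n : ℚ) • x ∈ Submodule.span ℚ s := by
    rw [Nat.cast_smul_eq_nsmul]
    exact Submodule.subset_span h
  exact (Submodule.smul_mem_iff _ (Nat.cast_ne_zero.2 hn)).1 hx

theorem span_inf_of_finite_quotient [Finite (M ⧸ L.submoduleOf M)] (hI : I ≤ M) :
    Submodule.span ℚ ((I ⊓ L : Submodule ℤ V) : Set V) = Submodule.span ℚ (I : Set V) := by
  obtain ⟨n, hn, h⟩ := exists_ne_zero_nsmul_mem (H := L) (K := M)
  refine le_antisymm (Submodule.span_mono inf_le_left) (Submodule.span_le.2 fun x hx => ?_)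
  exact mem_span_of_nsmul_mem hn ⟨I.smul_of_tower_mem n hx, h x (hI hx)⟩

theorem isLattice_of_finite_quotient (hM : Submodule.IsLattice ℚ M) (hLM : L ≤ M)
    [Finite (M ⧸ L.submoduleOf M)] : Submodule.IsLattice ℚ L where
  fg := isNoetherian_submodule.1 (inferInstance : IsNoetherian ℤ M) L hLM
  span_eq_top := by
    rw [← inf_eq_right.2 hLM, span_inf_of_finite_quotient le_rfl, hM.span_eq_top]

theorem IsEvenLattice.of_finite_quotient (hM : IsEvenLattice B M) (hLM : L ≤ M)
    [Finite (M ⧸ L.submoduleOf M)] : IsEvenLattice B L where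
  isLattice := isLattice_of_finite_quotient hM.isLattice hLM
  integral x hx y hy := hM.integral x (hLM hx) y (hLM hy)
  even x hx := hM.even x (hLM hx)

theorem IsEvenLattice.le_dual (hL : IsEvenLattice B L) : L ≤ B.dualSubmodule L :=
  fun x hx => mem_dual_iff.2 fun y hy => hL.integral x hx y hy

theorem dual_anti (h : L ≤ M) : B.dualSubmodule M ≤ B.dualSubmodule L :=
  fun _ hx y hy => hx y (h hy)

theorem dual_sup : B.dualSubmodule (L ⊔ M) = B.dualSubmodule L ⊓ B.dualSubmodule M := by
  refine le_antisymm (le_inf (dual_anti le_sup_left) (dual_anti le_sup_right)) ?_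
  intro x hx y hy
  obtain ⟨a, ha, b, hb, rfl⟩ := Submodule.mem_sup.1 hy
  rw [map_add]
  exact add_mem (hx.1 a ha) (hx.2 b hb)

theorem le_dual_comm (hB : B.IsSymm) : L ≤ B.dualSubmodule M ↔ M ≤ B.dualSubmodule L := by
  have hflip : B.flip = B := LinearMap.BilinForm.isSymm_iff_flip.1 hB
  rw [← B.le_flip_dualSubmodule, hflip]

theorem exists_basis_span_eq [FiniteDimensional ℚ V] (hL : Submodule.IsLattice ℚ L) :
    ∃ b : Module.Basis (Module.Free.ChooseBasisIndex ℤ L) ℚ V,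
      L = Submodule.span ℤ (Set.range b) := by
  let b := Module.Free.chooseBasis ℤ L
  have hrange : Set.range (b.extendOfIsLattice ℚ) = L.subtype '' Set.range b := by
    rw [← Set.range_comp]
    exact congrArg Set.range (funext fun i => by simp)
  refine ⟨b.extendOfIsLattice ℚ, ?_⟩
  rw [hrange, Submodule.span_image, b.span_eq, Submodule.map_top, Submodule.range_subtype]

theorem dual_dual [FiniteDimensional ℚ V] (hB : B.IsSymm) (hnd : B.Nondegenerate)
    (hL : Submodule.IsLattice ℚ L) : B.dualSubmodule (B.dualSubmodule L) = L := by
  obtain ⟨b, hb⟩ := exists_basis_span_eq hL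
  rw [hb]
  exact B.dualSubmodule_dualSubmodule_of_basis hnd hB b

theorem isLattice_dual [FiniteDimensional ℚ V] (hnd : B.Nondegenerate)
    (hL : Submodule.IsLattice ℚ L) : Submodule.IsLattice ℚ (B.dualSubmodule L) := by
  classical
  obtain ⟨b, hb⟩ := exists_basis_span_eq hL
  have hdual := LinearMap.BilinForm.dualSubmodule_span_of_basis (R := ℤ) B hnd b
  rw [← hb] at hdual
  refine ⟨hdual ▸ Submodule.fg_span (Set.finite_range _), ?_⟩
  rw [hdual, Submodule.span_span_of_tower (R := ℤ), (B.dualBasis hnd b).span_eq]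

theorem finite_discGroup [FiniteDimensional ℚ V] (hnd : B.Nondegenerate)
    (hL : Submodule.IsLattice ℚ L) (hLd : L ≤ B.dualSubmodule L) : Finite (DiscGroup B L) := by
  have := isLattice_dual hnd hL
  refine Submodule.finiteQuotientOfFreeOfRankEq _ ?_
  rw [(Submodule.submoduleOfEquivOfLe hLd).finrank_eq, Module.finrank, Module.finrank,
    Submodule.IsLattice.rank' ℚ L, Submodule.IsLattice.rank' ℚ (B.dualSubmodule L)]

end Lattices

/-! ### The discriminant pairing -/

theorem e_add (x y : ℚ) : e (x + y) = e x * e y := by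
  simp only [e, Rat.cast_add, mul_add, Complex.exp_add]

theorem e_eq_one_iff {x : ℚ} : e x = 1 ↔ ∃ n : ℤ, x = n := by
  rw [e, Complex.exp_eq_one_iff]
  refine exists_congr fun n => ?_
  rw [mul_comm, mul_left_inj' Complex.two_pi_I_ne_zero]
  norm_cast

theorem card_eq_card_mul_card_ker {A G : Type*} [AddCommGroup A] [Finite A] [AddCommGroup G]
    [Finite G] (φ : A →+ AddChar G ℂ) (hφ : ∀ g, (∀ a, φ a g = 1) → g = 0) :
    Nat.card A = Nat.card G * Nat.card φ.ker := by
  classical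
  have := Fintype.ofFinite A
  have := Fintype.ofFinite G
  have hrow (a : A) : ∑ g, φ a g = if a ∈ φ.ker then (Nat.card G : ℂ) else 0 := by
    rw [AddChar.sum_eq_ite, Nat.card_eq_fintype_card]
    exact if_congr AddMonoidHom.mem_ker.symm rfl rfl
  have hcol (g : G) : ∑ a, φ a g = if g = 0 then (Nat.card A : ℂ) else 0 := by
    have hsum := AddChar.sum_eq_ite ((AddChar.doubleDualEmb (M := ℂ) g).compAddMonoidHom φ)
    rw [← Nat.card_eq_fintype_card] at hsum
    refine hsum.trans (if_congr ?_ rfl rfl)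
    rw [AddChar.ext_iff]
    refine ⟨hφ g, ?_⟩
    rintro rfl a
    exact AddChar.map_zero_eq_one (φ a)
  have hswap : ∑ g, ∑ a, φ a g = ∑ a, ∑ g, φ a g := Finset.sum_comm
  simp only [hrow, hcol, Finset.sum_ite_eq', Finset.mem_univ, if_true, ← Finset.sum_filter,
    Finset.sum_const, nsmul_eq_mul, ← Fintype.card_subtype] at hswap
  rw [mul_comm, Nat.card_eq_fintype_card (α := φ.ker)]
  exact_mod_cast hswap

section DiscriminantPairing

variable {V : Type*} [AddCommGroup V] [Module ℚ V] {B : LinearMap.BilinForm ℚ V}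
  {L M : Submodule ℤ V}

theorem ePairNeg_mk_eq_one_iff (hB : B.IsSymm) (x y : B.dualSubmodule L) :
    ePairNeg B L (discMk B L x) (discMk B L y) = 1 ↔ ∃ n : ℤ, B x y = n := by
  rw [ePairNeg_mk hB, e_eq_one_iff]
  refine (Equiv.neg ℤ).exists_congr fun n => ?_
  rw [Equiv.neg_apply, Int.cast_neg, neg_eq_iff_eq_neg]

theorem ePairNeg_comm (hB : B.IsSymm) (l m : DiscGroup B L) :
    ePairNeg B L l m = ePairNeg B L m l :=
  congrArg (fun r => e (-r)) (hB.eq _ _)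

theorem ePairNeg_add_right (hB : B.IsSymm) (l m n : DiscGroup B L) :
    ePairNeg B L l (m + n) = ePairNeg B L l m * ePairNeg B L l n := by
  obtain ⟨x, rfl⟩ := Submodule.mkQ_surjective _ l
  obtain ⟨y, rfl⟩ := Submodule.mkQ_surjective _ m
  obtain ⟨z, rfl⟩ := Submodule.mkQ_surjective _ n
  rw [← map_add, ePairNeg_mk hB, ePairNeg_mk hB, ePairNeg_mk hB, ← e_add, ← neg_add, ← map_add]
  rfl

theorem ePairNeg_add_left (hB : B.IsSymm) (l m n : DiscGroup B L) :
    ePairNeg B L (l + m) n = ePairNeg B L l n * ePairNeg B L m n := by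
  simp only [ePairNeg_comm hB _ n, ePairNeg_add_right hB]

theorem ePairNeg_zero_right (hB : B.IsSymm) (l : DiscGroup B L) : ePairNeg B L l 0 = 1 := by
  obtain ⟨x, rfl⟩ := Submodule.mkQ_surjective _ l
  rw [← map_zero (discMk B L), ePairNeg_mk_eq_one_iff hB]
  exact ⟨0, by simp⟩

theorem ePairNeg_zero_left (hB : B.IsSymm) (l : DiscGroup B L) : ePairNeg B L 0 l = 1 := by
  rw [ePairNeg_comm hB, ePairNeg_zero_right hB]

/-- The subgroup `J = M / L` of `A_L` attached to an overlattice `L ⊆ M ⊆ L^∨`. In general it is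
the image of `M ∩ L^∨` in `A_L`, so that `overSub B L (B.dualSubmodule M)` is `J^⊥ = M^∨ / L`. -/
def overSub (B : LinearMap.BilinForm ℚ V) (L M : Submodule ℤ V) : Submodule ℤ (DiscGroup B L) :=
  (M.submoduleOf (B.dualSubmodule L)).map (discMk B L)

theorem discMk_mem_overSub (hLM : L ≤ M) {x : B.dualSubmodule L} :
    discMk B L x ∈ overSub B L M ↔ (x : V) ∈ M := by
  refine ⟨?_, fun h => ⟨x, h, rfl⟩⟩
  rintro ⟨y, hy, h⟩
  rw [discMk_eq_iff] at h
  exact (Submodule.sub_mem_iff_right M hy).1 (hLM h)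

/-- The restriction `A_L → Ĵ` of the discriminant pairing `e(-(λ, μ))` to `μ ∈ J = M / L`. -/
def overPairing (hB : B.IsSymm) (L M : Submodule ℤ V) :
    DiscGroup B L →+ AddChar (overSub B L M) ℂ where
  toFun l :=
    { toFun := fun j => ePairNeg B L l j
      map_zero_eq_one' := ePairNeg_zero_right hB l
      map_add_eq_mul' := fun i j => ePairNeg_add_right hB l i j }
  map_zero' := DFunLike.ext _ _ fun j : overSub B L M => ePairNeg_zero_left hB j.1
  map_add' l m := DFunLike.ext _ _ fun j : overSub B L M => ePairNeg_add_left hB l m j.1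

theorem overPairing_apply (hB : B.IsSymm) (l : DiscGroup B L) (j : overSub B L M) :
    overPairing hB L M l j = ePairNeg B L l j := rfl

theorem overPairing_mk_eq_zero_iff (hB : B.IsSymm) (hLM : L ≤ M) (hMd : M ≤ B.dualSubmodule L)
    (x : B.dualSubmodule L) :
    overPairing hB L M (discMk B L x) = 0 ↔ (x : V) ∈ B.dualSubmodule M := by
  rw [mem_dual_iff, AddChar.ext_iff]
  constructor
  · intro h y hy
    exact (ePairNeg_mk_eq_one_iff hB x ⟨y, hMd hy⟩).1
      (h ⟨discMk B L ⟨y, hMd hy⟩, (discMk_mem_overSub hLM).2 hy⟩)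
  · rintro h ⟨_, y, hy, rfl⟩
    exact (ePairNeg_mk_eq_one_iff hB x y).2 (h y hy)

theorem ker_overPairing (hB : B.IsSymm) (hLM : L ≤ M) (hMd : M ≤ B.dualSubmodule L) :
    (overPairing hB L M).ker = (overSub B L (B.dualSubmodule M)).toAddSubgroup := by
  ext l
  obtain ⟨x, rfl⟩ := Submodule.mkQ_surjective _ l
  rw [AddMonoidHom.mem_ker, overPairing_mk_eq_zero_iff hB hLM hMd, Submodule.mem_toAddSubgroup,
    discMk_mem_overSub ((le_dual_comm hB).1 hMd)]

theorem eq_zero_of_overPairing_eq_one [FiniteDimensional ℚ V] (hB : B.IsSymm)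
    (hnd : B.Nondegenerate) (hL : Submodule.IsLattice ℚ L) (j : overSub B L M)
    (hj : ∀ l, overPairing hB L M l j = 1) : j = 0 := by
  obtain ⟨_, y, hy, rfl⟩ := j
  have hyL : (y : V) ∈ B.dualSubmodule (B.dualSubmodule L) := by
    refine mem_dual_iff.2 fun x hx => ?_
    obtain ⟨n, hn⟩ := (ePairNeg_mk_eq_one_iff hB ⟨x, hx⟩ y).1 (hj _)
    exact ⟨n, (hB.eq _ _).trans hn⟩
  rw [dual_dual hB hnd hL] at hyL
  exact Subtype.ext ((Submodule.Quotient.mk_eq_zero _).2 hyL)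

open Classical in
theorem sum_ePairNeg_overSub (hB : B.IsSymm) (hLM : L ≤ M) (hMd : M ≤ B.dualSubmodule L)
    [Fintype (overSub B L M)] (x : B.dualSubmodule L) :
    ∑ j : overSub B L M, ePairNeg B L (discMk B L x) j =
      if (x : V) ∈ B.dualSubmodule M then (Nat.card (overSub B L M) : ℂ) else 0 := by
  simpa only [overPairing_apply, overPairing_mk_eq_zero_iff hB hLM hMd, Nat.card_eq_fintype_card]
    using AddChar.sum_eq_ite (overPairing hB L M (discMk B L x))

theorem card_overSub (hMd : M ≤ B.dualSubmodule L) :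
    Nat.card (overSub B L M) = L.toAddSubgroup.relIndex M.toAddSubgroup := by
  have hker : (discMk B L).toAddMonoidHom.ker =
      L.toAddSubgroup.addSubgroupOf (B.dualSubmodule L).toAddSubgroup := by
    ext x
    exact Submodule.Quotient.mk_eq_zero _
  have hcard := AddSubgroup.relIndex_ker (M.submoduleOf (B.dualSubmodule L)).toAddSubgroup
    (discMk B L).toAddMonoidHom
  rw [hker] at hcard
  exact hcard.symm.trans (AddSubgroup.relIndex_addSubgroupOf (K := M.toAddSubgroup) hMd)

theorem card_discGroup_eq_sq_mul [FiniteDimensional ℚ V] (hB : B.IsSymm) (hnd : B.Nondegenerate)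
    (hL : IsEvenLattice B L) (hM : M ≤ B.dualSubmodule M) (hLM : L ≤ M) :
    Nat.card (DiscGroup B L) = Nat.card (overSub B L M) ^ 2 * Nat.card (DiscGroup B M) := by
  have := finite_discGroup hnd hL.isLattice hL.le_dual
  have hMd : M ≤ B.dualSubmodule L := hM.trans (dual_anti hLM)
  have htower : Nat.card (overSub B L (B.dualSubmodule M)) =
      Nat.card (overSub B L M) * Nat.card (DiscGroup B M) := by
    rw [card_overSub (dual_anti hLM), card_overSub hMd]
    exact (AddSubgroup.relIndex_mul_relIndex L.toAddSubgroup M.toAddSubgroup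
      (B.dualSubmodule M).toAddSubgroup hLM hM).symm
  calc Nat.card (DiscGroup B L)
      = Nat.card (overSub B L M) * Nat.card (overPairing hB L M).ker :=
        card_eq_card_mul_card_ker _ (eq_zero_of_overPairing_eq_one hB hnd hL.isLattice)
    _ = Nat.card (overSub B L M) * Nat.card (overSub B L (B.dualSubmodule M)) := by
        rw [ker_overPairing hB hLM hMd]; rfl
    _ = Nat.card (overSub B L M) ^ 2 * Nat.card (DiscGroup B M) := by rw [htower]; ring

end DiscriminantPairing

/-! ### The pushforward of weakly holomorphic forms -/

section Pushforward

variable {V : Type*} [AddCommGroup V] [Module ℚ V] {B : LinearMap.BilinForm ℚ V}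
  {L M N : Submodule ℤ V}

theorem push_comp_push (hLM : L ≤ M) (hMN : M ≤ N) (hN : N ≤ B.dualSubmodule N) :
    push B M N ∘ₗ push B L M = push B L N := by
  refine Finsupp.lhom_ext' fun l => LinearMap.ext_ring ?_
  obtain ⟨⟨x, hx⟩, rfl⟩ := Submodule.mkQ_surjective _ l
  change push B M N (push B L M (basisVec B L _)) = push B L N (basisVec B L _)
  have hMN' : M ≤ B.dualSubmodule N := hMN.trans hN
  by_cases hxM : x ∈ B.dualSubmodule M
  · rw [push_basisVec_mk hLM x hx hxM]
    by_cases hxN : x ∈ B.dualSubmodule N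
    · rw [push_basisVec_mk hMN x hxM hxN, push_basisVec_mk (hLM.trans hMN) x hx hxN]
    · rw [push_basisVec_of_notMem hMN' x hxM hxN,
        push_basisVec_of_notMem (hLM.trans hMN') x hx hxN]
  · have hxN : x ∉ B.dualSubmodule N := fun h => hxM (dual_anti hMN h)
    rw [push_basisVec_of_notMem (hLM.trans (hMN'.trans (dual_anti hMN))) x hx hxM, map_zero,
      push_basisVec_of_notMem (hLM.trans hMN') x hx hxN]

open Classical in
theorem push_basisVec_mk_apply (hLM : L ≤ M) (hM : M ≤ B.dualSubmodule M)
    (x : B.dualSubmodule L) (y : B.dualSubmodule M) :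
    push B L M (basisVec B L (discMk B L x)) (discMk B M y) =
      if (x : V) - y ∈ M then 1 else 0 := by
  by_cases hx : (x : V) ∈ B.dualSubmodule M
  · rw [push_basisVec_mk hLM x x.2 hx, Finsupp.single_apply]
    exact if_congr discMk_eq_iff rfl rfl
  · rw [push_basisVec_of_notMem (hLM.trans hM) x x.2 hx, if_neg, Finsupp.zero_apply]
    exact fun h => hx ((Submodule.sub_mem_iff_left _ y.2).1 (hM h))

theorem push_apply (hLM : L ≤ M) (hM : M ≤ B.dualSubmodule M) [Fintype (overSub B L M)]
    (v : CA B L) (y : B.dualSubmodule M) :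
    push B L M v (discMk B M y) =
      ∑ j : overSub B L M, v (discMk B L ⟨y, dual_anti hLM y.2⟩ + j) := by
  classical
  induction v using Finsupp.induction_linear with
  | zero => simp
  | add v w hv hw => simp only [map_add, Finsupp.add_apply, hv, hw, Finset.sum_add_distrib]
  | single l c =>
    obtain ⟨x, rfl⟩ := Submodule.mkQ_surjective _ l
    set y' : B.dualSubmodule L := ⟨y, dual_anti hLM y.2⟩
    have hfibre (j : overSub B L M) :
        discMk B L x = discMk B L y' + j ↔ (j : DiscGroup B L) = discMk B L (x - y') := by
      rw [map_sub, eq_sub_iff_add_eq', eq_comm]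
    have hmem : discMk B L (x - y') ∈ overSub B L M ↔ (x : V) - y ∈ M := discMk_mem_overSub hLM
    rw [← Finsupp.smul_single_one, map_smul, Finsupp.smul_apply,
      push_basisVec_mk_apply hLM hM, ← hmem]
    simp only [Finsupp.smul_apply, Finsupp.single_apply, hfibre, ← Finset.smul_sum]
    congr 1
    split_ifs with h
    · simp only [← Subtype.ext_iff (a2 := ⟨_, h⟩), Finset.sum_ite_eq', Finset.mem_univ, if_true]
    · refine (Finset.sum_eq_zero fun j _ => if_neg ?_).symm
      exact fun hj : (j : DiscGroup B L) = discMk B L (x - y') => h (hj ▸ j.2)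

theorem push_comp_weilT (hB : B.IsSymm) (hL : IsEvenLattice B L) (hM : IsEvenLattice B M)
    (hLM : L ≤ M) : push B L M ∘ₗ weilT B L = weilT B M ∘ₗ push B L M := by
  refine Finsupp.lhom_ext' fun l => LinearMap.ext_ring ?_
  obtain ⟨⟨x, hx⟩, rfl⟩ := Submodule.mkQ_surjective _ l
  change push B L M (weilT B L (basisVec B L _)) = weilT B M (push B L M (basisVec B L _))
  rw [weilT, Finsupp.linearCombination_single, one_smul, map_smul]
  by_cases hxM : x ∈ B.dualSubmodule M
  · rw [push_basisVec_mk hLM x hx hxM, weilT, Finsupp.linearCombination_single, one_smul,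
      eQuad_mk hB hL, eQuad_mk hB hM]
  · rw [push_basisVec_of_notMem (hLM.trans hM.le_dual) x hx hxM, map_zero, smul_zero]

/-- The scalar factor `e(-σ/8) / √|A_L|` of `ρ_L(S)`. -/
def weilSFactor (B : LinearMap.BilinForm ℚ V) (L : Submodule ℤ V) : ℂ :=
  e (-(sigma B : ℚ) / 8) / (Real.sqrt (Nat.card (DiscGroup B L)) : ℂ)

theorem weilS_basisVec_apply [Finite (DiscGroup B L)] (l m : DiscGroup B L) :
    weilS B L (basisVec B L l) m = weilSFactor B L * ePairNeg B L l m := by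
  classical
  have := Fintype.ofFinite (DiscGroup B L)
  rw [weilS, Finsupp.linearCombination_single, one_smul, finsum_eq_sum_of_fintype]
  simp only [Finsupp.smul_apply, Finsupp.finsetSum_apply, Finsupp.single_apply, smul_eq_mul,
    mul_ite, mul_one, mul_zero, Finset.sum_ite_eq', Finset.mem_univ, if_true, weilSFactor]

theorem weilSFactor_mul_card_overSub [FiniteDimensional ℚ V] (hB : B.IsSymm)
    (hnd : B.Nondegenerate) (hL : IsEvenLattice B L) (hM : M ≤ B.dualSubmodule M) (hLM : L ≤ M) :
    weilSFactor B L * Nat.card (overSub B L M) = weilSFactor B M := by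
  have := finite_discGroup hnd hL.isLattice hL.le_dual
  have hJ : (Nat.card (overSub B L M) : ℂ) ≠ 0 := Nat.cast_ne_zero.2 Nat.card_pos.ne'
  rw [weilSFactor, weilSFactor, card_discGroup_eq_sq_mul hB hnd hL hM hLM, Nat.cast_mul,
    Nat.cast_pow, Real.sqrt_mul (by positivity), Real.sqrt_sq (by positivity), Complex.ofReal_mul,
    Complex.ofReal_natCast, div_mul_eq_mul_div, mul_comm, mul_div_mul_left _ _ hJ]

theorem push_comp_weilS [FiniteDimensional ℚ V] (hB : B.IsSymm) (hnd : B.Nondegenerate)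
    (hL : IsEvenLattice B L) (hM : IsEvenLattice B M) (hLM : L ≤ M) :
    push B L M ∘ₗ weilS B L = weilS B M ∘ₗ push B L M := by
  classical
  have := finite_discGroup hnd hL.isLattice hL.le_dual
  have := finite_discGroup hnd hM.isLattice hM.le_dual
  have := Fintype.ofFinite (overSub B L M)
  have hMd : M ≤ B.dualSubmodule L := hM.le_dual.trans (dual_anti hLM)
  refine Finsupp.lhom_ext' fun l => LinearMap.ext_ring (Finsupp.ext fun m => ?_)
  obtain ⟨⟨x, hx⟩, rfl⟩ := Submodule.mkQ_surjective _ l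
  obtain ⟨y, rfl⟩ := Submodule.mkQ_surjective _ m
  change push B L M (weilS B L (basisVec B L _)) _ = weilS B M (push B L M (basisVec B L _)) _
  have hleft : push B L M (weilS B L (basisVec B L (discMk B L ⟨x, hx⟩))) (discMk B M y) =
      weilSFactor B L * (e (-(B x y)) *
        if x ∈ B.dualSubmodule M then (Nat.card (overSub B L M) : ℂ) else 0) := by
    rw [push_apply hLM hM.le_dual]
    simp only [weilS_basisVec_apply, ePairNeg_add_right hB, ePairNeg_mk hB, ← Finset.mul_sum,
      sum_ePairNeg_overSub hB hLM hMd]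
  rw [hleft]
  by_cases hxM : x ∈ B.dualSubmodule M
  · rw [if_pos hxM, push_basisVec_mk hLM x hx hxM, weilS_basisVec_apply, ePairNeg_mk hB,
      ← weilSFactor_mul_card_overSub hB hnd hL hM.le_dual hLM]
    ring
  · rw [if_neg hxM, push_basisVec_of_notMem (hLM.trans hM.le_dual) x hx hxM, map_zero, mul_zero,
      mul_zero, Finsupp.zero_apply]

theorem exists_mem_weilGraph_push_comp_eq [FiniteDimensional ℚ V] (hB : B.IsSymm)
    (hnd : B.Nondegenerate) (hL : IsEvenLattice B L) (hM : IsEvenLattice B M) (hLM : L ≤ M)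
    {a : Mp2Z × Module.End ℂ (CA B M)} (ha : a ∈ weilGraph B M) :
    ∃ R : Module.End ℂ (CA B L), (a.1, R) ∈ weilGraph B L ∧
      push B L M ∘ₗ R = a.2 ∘ₗ push B L M := by
  induction ha using Submonoid.closure_induction with
  | mem a ha =>
    rcases ha with rfl | rfl
    · exact ⟨weilT B L, Submonoid.subset_closure (Or.inl rfl), push_comp_weilT hB hL hM hLM⟩
    · exact ⟨weilS B L, Submonoid.subset_closure (Or.inr rfl), push_comp_weilS hB hnd hL hM hLM⟩
  | one => exact ⟨1, Submonoid.one_mem _, rfl⟩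
  | mul a b _ _ ha hb =>
    obtain ⟨R, hR, hRa⟩ := ha
    obtain ⟨S, hS, hSb⟩ := hb
    refine ⟨R * S, Submonoid.mul_mem _ hR hS, ?_⟩
    calc push B L M ∘ₗ (R ∘ₗ S) = a.2 ∘ₗ (push B L M ∘ₗ S) := by
          rw [← LinearMap.comp_assoc, hRa, LinearMap.comp_assoc]
      _ = (a.2 ∘ₗ b.2) ∘ₗ push B L M := by rw [hSb, LinearMap.comp_assoc]

theorem mdifferentiable_finset_sum {ι : Type*} (s : Finset ι) {f : ι → ℍ → ℂ}
    (hf : ∀ i ∈ s, MDifferentiable 𝓘(ℂ) 𝓘(ℂ) (f i)) :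
    MDifferentiable 𝓘(ℂ) 𝓘(ℂ) fun τ => ∑ i ∈ s, f i τ := by
  induction s using Finset.cons_induction with
  | empty => simpa only [Finset.sum_empty] using mdifferentiable_const
  | cons i s hi ih =>
    simp only [Finset.sum_cons]
    exact (hf i (Finset.mem_cons_self i s)).add
      (ih fun j hj => hf j (Finset.mem_cons_of_mem hj))

theorem isBigO_exp_of_le {a b : ℝ} (hab : a ≤ b) :
    (fun τ : ℍ => Real.exp (2 * Real.pi * a * τ.im)) =O[atImInfty]
      fun τ : ℍ => Real.exp (2 * Real.pi * b * τ.im) := by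
  refine Asymptotics.IsBigO.of_norm_le fun τ => ?_
  rw [Real.norm_of_nonneg (Real.exp_pos _).le, Real.exp_le_exp]
  have := τ.im_pos
  gcongr

theorem IsWeaklyHolomorphic.push [FiniteDimensional ℚ V] (hB : B.IsSymm) (hnd : B.Nondegenerate)
    (hL : IsEvenLattice B L) (hM : IsEvenLattice B M) (hLM : L ≤ M) {f : ℍ → CA B L}
    (hf : IsWeaklyHolomorphic B L f) :
    IsWeaklyHolomorphic B M fun τ => ThetaProduct.push B L M (f τ) := by
  have := finite_discGroup hnd hL.isLattice hL.le_dual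
  have := Fintype.ofFinite (overSub B L M)
  refine ⟨fun m => ?_, fun g R hR τ => ?_, fun m => ?_⟩
  · obtain ⟨y, rfl⟩ := Submodule.mkQ_surjective _ m
    simp only [push_apply hLM hM.le_dual]
    exact mdifferentiable_finset_sum _ fun j _ => hf.holo _
  · obtain ⟨R', hR', hRR'⟩ := exists_mem_weilGraph_push_comp_eq hB hnd hL hM hLM hR
    rw [hf.modular g R' hR' τ, map_smul]
    exact congrArg _ (LinearMap.congr_fun hRR' (f τ))
  · obtain ⟨y, rfl⟩ := Submodule.mkQ_surjective _ m
    simp only [push_apply hLM hM.le_dual]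
    choose k hk using fun j : overSub B L M => hf.cusp (discMk B L ⟨y, dual_anti hLM y.2⟩ + j)
    refine ⟨Finset.univ.sup k, Asymptotics.IsBigO.fun_sum fun j _ => (hk j).trans ?_⟩
    exact isBigO_exp_of_le (Nat.cast_le.2 (Finset.le_sup (Finset.mem_univ j)))

/-- The pushforward `↓^L_M` as a linear map `M^!(L) → M^!(M)` of spaces of weakly holomorphic
modular forms. -/
def pushMShriek [FiniteDimensional ℚ V] (hB : B.IsSymm) (hnd : B.Nondegenerate)
    (hL : IsEvenLattice B L) (hM : IsEvenLattice B M) (hLM : L ≤ M) :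
    MShriek B L →ₗ[ℂ] MShriek B M where
  toFun f := ⟨fun τ => push B L M (f.1 τ), f.2.push hB hnd hL hM hLM⟩
  map_add' f g := Subtype.ext (funext fun τ => map_add (push B L M) (f.1 τ) (g.1 τ))
  map_smul' c f := Subtype.ext (funext fun τ => map_smul (push B L M) c (f.1 τ))

end Pushforward

/-! ### Compatibility with the `Θ`-product -/

section Compatibility

variable {V : Type*} [AddCommGroup V] [Module ℚ V] {B : LinearMap.BilinForm ℚ V}
  {L M I I' : Submodule ℤ V}

theorem le_Istar (hI : I ≤ B.dualSubmodule L) : I ≤ Istar B L I :=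
  fun _ hx => ⟨Submodule.subset_span hx, hI hx⟩

theorem Istar_sup (hB : B.IsSymm) (hI : ∀ x ∈ I, ∀ y ∈ I, B x y = 0)
    (hspan : Submodule.span ℚ (I' : Set V) = Submodule.span ℚ (I : Set V)) :
    Istar B (L ⊔ I) I = Istar B L I' := by
  have hU : (Submodule.span ℚ (I : Set V)).restrictScalars ℤ ≤ B.dualSubmodule I := by
    refine fun x hx => mem_dual_iff.2 fun i hi => ⟨0, ?_⟩
    rw [← hB.eq, Int.cast_zero]
    exact span_isotropic hI hx i (Submodule.subset_span hi)
  rw [Istar, Istar, hspan, dual_sup, inf_comm (B.dualSubmodule L), ← inf_assoc,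
    inf_eq_left.2 hU]

theorem Lstar_sup (hB : B.IsSymm) (hI : ∀ x ∈ I, ∀ y ∈ I, B x y = 0)
    (hspan : Submodule.span ℚ (I' : Set V) = Submodule.span ℚ (I : Set V))
    (hIL : I ≤ B.dualSubmodule (L ⊔ I)) : Lstar B (L ⊔ I) I = Lstar B L I' := by
  rw [Lstar, Lstar, sup_assoc, sup_eq_right.2 (le_Istar hIL), Istar_sup hB hI hspan]

theorem le_dual_Lstar (hB : B.IsSymm) (hL : L ≤ B.dualSubmodule L) :
    L ≤ B.dualSubmodule (Lstar B L I) := by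
  rw [Lstar, dual_sup]
  exact le_inf hL ((le_dual_comm hB).1 inf_le_right)

theorem Lstar_le_dual_Lstar (hB : B.IsSymm) (hL : L ≤ B.dualSubmodule L)
    (hI : ∀ x ∈ I, ∀ y ∈ I, B x y = 0) : Lstar B L I ≤ B.dualSubmodule (Lstar B L I) := by
  refine sup_le (le_dual_Lstar hB hL) ?_
  rw [Lstar, dual_sup]
  refine le_inf inf_le_right fun x hx => mem_dual_iff.2 fun y hy => ⟨0, ?_⟩
  rw [Int.cast_zero]
  exact span_isotropic hI hy.1 x hx.1

/-- The image of `L ∩ U^⊥` in `U^⊥ / U`. For `U = I_ℚ` it is the lattice `K = latticeK B L I`; it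
is stated for a subspace `U` because `K` depends on `I` only through `I_ℚ`. -/
def quotLattice (B : LinearMap.BilinForm ℚ V) (U : Submodule ℚ V) (L : Submodule ℤ V) :
    Submodule ℤ (B.orthogonal U ⧸ U.submoduleOf (B.orthogonal U)) :=
  (L.submoduleOf ((B.orthogonal U).restrictScalars ℤ)).map
    ((U.submoduleOf (B.orthogonal U)).mkQ.restrictScalars ℤ)

theorem quotLattice_sup {U : Submodule ℚ V} (hU : U ≤ B.orthogonal U)
    (hIU : I ≤ U.restrictScalars ℤ) : quotLattice B U (L ⊔ I) = quotLattice B U L := by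
  refine le_antisymm ?_ (Submodule.map_mono (Submodule.comap_mono le_sup_left))
  rintro _ ⟨⟨x, hx⟩, hxLI, rfl⟩
  obtain ⟨a, ha, i, hi, rfl⟩ := Submodule.mem_sup.1 hxLI
  have haU : a ∈ B.orthogonal U := (Submodule.add_mem_iff_left _ (hU (hIU hi))).1 hx
  refine ⟨⟨a, haU⟩, ha, (Submodule.Quotient.eq _).2 ?_⟩
  change a - (a + i) ∈ U
  rw [sub_add_cancel_left]
  exact U.neg_mem (hIU hi)

theorem thetaSeries_quotLattice_congr (hB : B.IsSymm) {U U' : Submodule ℚ V} (hU : U' = U)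
    (hLM : quotLattice B U L = quotLattice B U M) {x : V}
    {hx : x ∈ B.orthogonal U} {hx' : x ∈ B.orthogonal U'}
    (hxM : Submodule.Quotient.mk ⟨x, hx⟩ ∈ (quotForm hB U).dualSubmodule (quotLattice B U M))
    (hxL : Submodule.Quotient.mk ⟨x, hx'⟩ ∈ (quotForm hB U').dualSubmodule (quotLattice B U' L))
    (τ : ℍ) :
    thetaSeries (quotForm hB U') (quotLattice B U' L) τ (discMk _ _ ⟨_, hxL⟩) =
      thetaSeries (quotForm hB U) (quotLattice B U M) τ (discMk _ _ ⟨_, hxM⟩) := by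
  subst hU
  revert hxL
  rw [hLM]
  exact fun _ => rfl

/-- The functional `v ↦ ⟨v, Θ_{K⁺}(τ)⟩` on `ℂA_{L^*} = ℂA_K`. -/
def starTheta (hB : B.IsSymm) (L I : Submodule ℤ V) (τ : ℍ) : CA B (Lstar B L I) →ₗ[ℂ] ℂ :=
  Finsupp.linearCombination ℂ fun l =>
    thetaSeries (quotB hB I) (latticeK B L I) τ (discIso hB L I l)

theorem xi_eq_starTheta (hB : B.IsSymm) (f : ℍ → CA B L) (τ : ℍ) :
    xi hB L I f τ = starTheta hB L I τ (push B L (Lstar B L I) (f τ)) :=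
  Finsupp.linearCombination_mapDomain ..

theorem starTheta_basisVec_mk (hB : B.IsSymm) (hI : ∀ x ∈ I, ∀ y ∈ I, B x y = 0)
    (x : B.orthogonal (Submodule.span ℚ (I : Set V)))
    (hx : (x : V) ∈ B.dualSubmodule (Lstar B L I)) (τ : ℍ) :
    starTheta hB L I τ (basisVec B (Lstar B L I) (discMk B (Lstar B L I) ⟨x, hx⟩)) =
      thetaSeries (quotB hB I) (latticeK B L I) τ
        (discMk _ _ ⟨quotMk B I x, quotMk_mem_dual hB L I x hx⟩) := by
  rw [starTheta, Finsupp.linearCombination_single, one_smul, discIso_mk hB hI]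

theorem starTheta_sup_comp_push (hB : B.IsSymm) (hnd : B.Nondegenerate) (hL : IsEvenLattice B L)
    (hI'L : I' ≤ L) (hI : ∀ x ∈ I, ∀ y ∈ I, B x y = 0)
    (hspan : Submodule.span ℚ (I' : Set V) = Submodule.span ℚ (I : Set V))
    (hstar : Lstar B (L ⊔ I) I = Lstar B L I') (τ : ℍ) :
    starTheta hB (L ⊔ I) I τ ∘ₗ push B L (Lstar B (L ⊔ I) I) =
      starTheta hB L I' τ ∘ₗ push B L (Lstar B L I') := by
  refine Finsupp.lhom_ext' fun l => LinearMap.ext_ring ?_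
  obtain ⟨⟨x, hx⟩, rfl⟩ := Submodule.mkQ_surjective _ l
  change starTheta hB (L ⊔ I) I τ (push B L _ (basisVec B L (discMk B L ⟨x, hx⟩))) =
    starTheta hB L I' τ (push B L _ (basisVec B L (discMk B L ⟨x, hx⟩)))
  have hI' : ∀ x ∈ I', ∀ y ∈ I', B x y = 0 := fun x hx y hy =>
    span_isotropic hI (hspan ▸ Submodule.subset_span hy) x (hspan ▸ Submodule.subset_span hx)
  have hLd : L ≤ B.dualSubmodule (Lstar B L I') := le_dual_Lstar hB hL.le_dual
  by_cases hxs : x ∈ B.dualSubmodule (Lstar B L I')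
  · obtain ⟨y, hy, hz'⟩ := exists_sub_mem_orthogonal hB hnd hL hI'L x hxs
    have hzs' : x - y ∈ B.dualSubmodule (Lstar B L I') := sub_mem hxs (hLd hy)
    have hzs : x - y ∈ B.dualSubmodule (Lstar B (L ⊔ I) I) := hstar ▸ hzs'
    have hz : x - y ∈ B.orthogonal (Submodule.span ℚ (I : Set V)) := hspan ▸ hz'
    have hzL : x - y ∈ B.dualSubmodule L := dual_anti le_sup_left hzs'
    have hclass : discMk B L ⟨x, hx⟩ = discMk B L ⟨x - y, hzL⟩ :=
      discMk_eq_iff.2 (by simpa only [sub_sub_cancel] using hy)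
    rw [hclass, push_basisVec_mk (le_sup_left.trans le_sup_left) _ hzL hzs,
      push_basisVec_mk le_sup_left _ hzL hzs', starTheta_basisVec_mk hB hI ⟨x - y, hz⟩,
      starTheta_basisVec_mk hB hI' ⟨x - y, hz'⟩]
    exact (thetaSeries_quotLattice_congr hB hspan
      (quotLattice_sup (span_isotropic hI) Submodule.subset_span).symm _ _ τ).symm
  · rw [push_basisVec_of_notMem (hstar ▸ hLd) x hx (hstar ▸ hxs),
      push_basisVec_of_notMem hLd x hx hxs, map_zero, map_zero]

theorem xi_push (hB : B.IsSymm) (hnd : B.Nondegenerate) (hL : IsEvenLattice B L)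
    (hLI : L ⊔ I ≤ B.dualSubmodule (L ⊔ I)) (hI'L : I' ≤ L)
    (hI : ∀ x ∈ I, ∀ y ∈ I, B x y = 0)
    (hspan : Submodule.span ℚ (I' : Set V) = Submodule.span ℚ (I : Set V))
    (f : ℍ → CA B L) (τ : ℍ) :
    xi hB (L ⊔ I) I (fun τ => push B L (L ⊔ I) (f τ)) τ = xi hB L I' f τ := by
  have hstar := Lstar_sup hB hI hspan (le_sup_right.trans hLI)
  rw [xi_eq_starTheta, xi_eq_starTheta, ← LinearMap.comp_apply (push B (L ⊔ I) _),
    push_comp_push le_sup_left le_sup_left (Lstar_le_dual_Lstar hB hLI hI)]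
  exact LinearMap.congr_fun (starTheta_sup_comp_push hB hnd hL hI'L hI hspan hstar τ) (f τ)

theorem thetaProd_push (hB : B.IsSymm) (hnd : B.Nondegenerate) (hL : IsEvenLattice B L)
    (hLI : L ⊔ I ≤ B.dualSubmodule (L ⊔ I)) (hI'L : I' ≤ L)
    (hI : ∀ x ∈ I, ∀ y ∈ I, B x y = 0)
    (hspan : Submodule.span ℚ (I' : Set V) = Submodule.span ℚ (I : Set V))
    (f g : ℍ → CA B L) (τ : ℍ) :
    thetaProd hB (L ⊔ I) I (fun τ => push B L (L ⊔ I) (f τ))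
        (fun τ => push B L (L ⊔ I) (g τ)) τ =
      push B L (L ⊔ I) (thetaProd hB L I' f g τ) := by
  rw [thetaProd, thetaProd, map_smul, xi_push hB hnd hL hLI hI'L hI hspan]

end Compatibility

end

end ThetaProduct

theorem mainTheorem7 {V : Type*} [AddCommGroup V] [Module ℚ V] [FiniteDimensional ℚ V]
    (B : LinearMap.BilinForm ℚ V) (hB : B.IsSymm) (hnd : B.Nondegenerate)
    (p q : ℕ) (hp : sigPos B.toQuadraticMap = p)
    (hq : sigNeg B.toQuadraticMap = q) (hpq : p ≤ q)
    (L L' I : Submodule ℤ V) (hL : ThetaProduct.IsEvenLattice B L)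
    (hI : ThetaProduct.IsMaximalIsotropic B L I p)
    (hL' : L' ≤ L) (hfin : Finite (L ⧸ L'.submoduleOf L)) (hgen : L = L' ⊔ I) :
    ∃ Φ : ThetaProduct.MShriek B L' →ₗ[ℂ] ThetaProduct.MShriek B L,
      (∀ (f : ThetaProduct.MShriek B L') (τ : UpperHalfPlane),
        (Φ f).1 τ = ThetaProduct.push B L' L (f.1 τ)) ∧
      ∀ (f g : ThetaProduct.MShriek B L') (τ : UpperHalfPlane),
        ThetaProduct.thetaProd hB L I (Φ f).1 (Φ g).1 τ =
          ThetaProduct.push B L' L (ThetaProduct.thetaProd hB L' (I ⊓ L') f.1 g.1 τ) := by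
  subst hgen
  have hL'even : ThetaProduct.IsEvenLattice B L' := hL.of_finite_quotient hL'
  exact ⟨ThetaProduct.pushMShriek hB hnd hL'even hL hL', fun _ _ => rfl, fun f g τ =>
    ThetaProduct.thetaProd_push hB hnd hL'even hL.le_dual inf_le_right hI.isotropic
      (ThetaProduct.span_inf_of_finite_quotient hI.le) f.1 g.1 τ⟩
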